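/- Let $K$ be a field whose characteristic does not divide $24=|S_4|$ (that is, $\mathrm{char}(K)\notin\{2,3\}$). For a finite group $G$ and an $n$-dimensional $KG$-module $V$, let $K[V]=K[x_1,\dots,x_n]$ be the polynomial ring on $V$ with the induced $G$-action and $K[V]^G$ its subalgebra of $G$-invariant polynomials. A subset $S\subseteq K[V]^G$ is called separating if for all $v,w\in V$ with $G\cdot v\neq G\cdot w$ there is an $f\in S$ with $f(v)\neq f(w)$. Let $\beta_{\mathrm{sep}}(G,V)$ be the minimal positive integer $d$ such that the elements of degree at most $d$ in $K[V]^G$ form a separating set, and let $\beta_{\mathrm{sep}}^K(G)$ be the supremum of $\beta_{\mathrm{sep}}(G,V)$ as $V$ ranges over all finite dimensional $KG$-modules. Theorem. Assume that $K$ contains an element of multiplicative order $24$ or that $\mathrm{char}(K)\neq 5$. Then $$\beta_{\mathrm{sep}}^K(S_4)=9,$$ where $S_4$ is the symmetric group of degree $4$. -/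

import Mathlib

namespace SepNoether

noncomputable section

variable {K : Type*} [Field K] {G : Type*} [Group G] {n : ℕ}

/-- The action of `g : G` on `K[V] = K[x₁, …, xₙ]` induced by the linear action
`g · v = ψ(g) v` on `V = Kⁿ`: the `K`-algebra map with `g · x_j = ∑ i, ψ(g⁻¹)_{ji} x_i`. -/
def polyAct (ψ : G →* Matrix.GeneralLinearGroup (Fin n) K) (g : G) :
    MvPolynomial (Fin n) K →ₐ[K] MvPolynomial (Fin n) K :=
  MvPolynomial.aeval fun j =>
    ∑ i, MvPolynomial.C ((ψ g⁻¹ : Matrix (Fin n) (Fin n) K) j i) * MvPolynomial.X i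

/-- The algebra `K[V]^G` of invariant polynomials. -/
def invariants (ψ : G →* Matrix.GeneralLinearGroup (Fin n) K) :
    Subalgebra K (MvPolynomial (Fin n) K) where
  carrier := {f | ∀ g, polyAct ψ g f = f}
  mul_mem' := fun ha hb g => by rw [map_mul, ha g, hb g]
  add_mem' := fun ha hb g => by rw [map_add, ha g, hb g]
  algebraMap_mem' := fun r g => (polyAct ψ g).commutes r

/-- The orbit `G · v` of `v ∈ V = Kⁿ`. -/
def orbit (ψ : G →* Matrix.GeneralLinearGroup (Fin n) K) (v : Fin n → K) : Set (Fin n → K) :=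
  Set.range fun g : G => Matrix.mulVec (ψ g : Matrix (Fin n) (Fin n) K) v

/-- A set of invariants is separating if any two points with different orbits
are distinguished by one of its elements. -/
def IsSeparatingSet (ψ : G →* Matrix.GeneralLinearGroup (Fin n) K)
    (S : Set (MvPolynomial (Fin n) K)) : Prop :=
  S ⊆ invariants ψ ∧
    ∀ v w : Fin n → K, orbit ψ v ≠ orbit ψ w →
      ∃ f ∈ S, MvPolynomial.eval v f ≠ MvPolynomial.eval w f

/-- `β_sep(G, V)`: the minimal positive integer `d` such that the invariants of degree at most `d`
form a separating set (with value `⊤` if there were no such `d`). -/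
def sepNoetherOf (ψ : G →* Matrix.GeneralLinearGroup (Fin n) K) : ℕ∞ :=
  ⨅ (d : ℕ) (_ : 0 < d ∧ IsSeparatingSet ψ {f | f ∈ invariants ψ ∧ f.totalDegree ≤ d}), (d : ℕ∞)

variable (K G) in
/-- `β_sep^K(G)`: the supremum of `β_sep(G, V)` over all finite dimensional `KG`-modules `V`;
up to isomorphism these are the spaces `Kⁿ` with `G` acting through a homomorphism
`G → GLₙ(K)`. -/
def sepNoetherNumber : ℕ∞ :=
  ⨆ (n : ℕ) (ψ : G →* Matrix.GeneralLinearGroup (Fin n) K), sepNoetherOf ψ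

end

end SepNoether

/-! The symmetric group permutes the three partitions of four points into pairs ("axes"), with
kernel the Klein four group. Signed permutations of the axes, untwisted or twisted by the sign
character, give the two 3-dimensional irreducibles. The group algebra therefore provides
vector-valued linear coordinates `aC`, `bC` (signed), `cC` (permuted) and `dC` (sign), and these
together determine the point.

Upper bound. Since 24 is invertible, agreement of all invariants of degree at most 9 at `v` and `w`
means that sums of polynomial functions of degree at most 9 over the two orbits agree (`Moments`).
Take functions `e 0, e 1, e 2` of degree at most 2 permuted like the axes. If their values at `v`
are distinct, their discriminant product, of degree 6, vanishes on the orbit outside a Klein coset.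
This leaves degree 3, and Klein invariants of degree 3 separate Klein orbits
(`exists_act_eq_of_kleinInvariant`). If exactly two values agree, a factor of degree 2 isolates a
subgroup of order 8, and products of two Klein invariants settle the remaining ambiguity
(`exists_act_eq_of_pair`). If every such family is constant, the coordinates on different axes agree
up to sign, and explicit invariants of low degree suffice.

Lower bound. In the rotation representation no nonzero invariant of odd degree below 9 exists, the
first surviving exponents being 1, 3, 5. So `v` and `-v` are not separated in degree 8, yet their
orbits differ when the squares of the coordinates of `v` are distinct and nonzero. The field
hypothesis supplies such a `v`. -/

namespace SepNoether

noncomputable section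

/-! ### Signed action on the three axes. -/

/-- The sign vectors of the three partitions of `Fin 4` into two pairs. -/
def pairSign (j : Fin 3) (i : Fin 4) : ℤˣ := if i = 0 ∨ i = j.succ then 1 else -1

/-- The permutation of the three pair partitions induced by `g`. -/
def axis (g : Equiv.Perm (Fin 4)) (j : Fin 3) : Fin 3 :=
  if pairSign j (g 0) = pairSign j (g 1) then 0
  else if pairSign j (g 0) = pairSign j (g 2) then 1 else 2

/-- The sign by which `g` acts on the axis `j`. -/
def axisSign (g : Equiv.Perm (Fin 4)) (j : Fin 3) : ℤˣ := pairSign j (g 0)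

/-- The first row of the signed permutation matrix of `g`. -/
def aWeight (j : Fin 3) (g : Equiv.Perm (Fin 4)) : ℤ := if axis g 0 = j then axisSign g 0 else 0

/-- The first row of the signed permutation matrix of `g`, twisted by the sign of `g`. -/
def bWeight (j : Fin 3) (g : Equiv.Perm (Fin 4)) : ℤ := Equiv.Perm.sign g * aWeight j g

/-- The first row of the permutation matrix of `g` on the axes. -/
def cWeight (j : Fin 3) (g : Equiv.Perm (Fin 4)) : ℤ := if axis g 0 = j then 1 else 0

/-- The sign character. -/
def dWeight (g : Equiv.Perm (Fin 4)) : ℤ := Equiv.Perm.sign g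

/-- A rotation moving the axes cyclically. -/
def axisRot : Equiv.Perm (Fin 4) := Equiv.swap 2 3 * Equiv.swap 1 2

set_option maxRecDepth 20000

theorem axis_one (j : Fin 3) : axis 1 j = j := by revert j; decide +kernel

theorem axisSign_one (j : Fin 3) : axisSign 1 j = 1 := by revert j; decide +kernel

/-- The order is reversed because `g` acts by pulling sign vectors back along `g`. -/
theorem axis_mul (g h : Equiv.Perm (Fin 4)) (j : Fin 3) :
    axis (g * h) j = axis h (axis g j) := by
  revert g h j; decide +kernel

theorem axisSign_mul (g h : Equiv.Perm (Fin 4)) (j : Fin 3) :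
    axisSign (g * h) j = axisSign g j * axisSign h (axis g j) := by
  revert g h j; decide +kernel

theorem aWeight_mul_inv (h : Equiv.Perm (Fin 4)) (j : Fin 3) (g : Equiv.Perm (Fin 4)) :
    aWeight j (g * h⁻¹) = axisSign h j * aWeight (axis h j) g := by
  revert h j g; decide +kernel

theorem bWeight_mul_inv (h : Equiv.Perm (Fin 4)) (j : Fin 3) (g : Equiv.Perm (Fin 4)) :
    bWeight j (g * h⁻¹) = ((Equiv.Perm.sign h * axisSign h j : ℤˣ) : ℤ) * bWeight (axis h j) g := by
  simp only [bWeight, aWeight_mul_inv, map_mul, Equiv.Perm.sign_inv]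
  push_cast
  ring

theorem cWeight_mul_inv (h : Equiv.Perm (Fin 4)) (j : Fin 3) (g : Equiv.Perm (Fin 4)) :
    cWeight j (g * h⁻¹) = cWeight (axis h j) g := by
  revert h j g; decide +kernel

theorem dWeight_mul_inv (h g : Equiv.Perm (Fin 4)) :
    dWeight (g * h⁻¹) = ((Equiv.Perm.sign h : ℤˣ) : ℤ) * dWeight g := by
  simp [dWeight, mul_comm]

/-- The regular character is the sum of the irreducible characters times their degrees. Row `j` of
`g` is row 0 of `axisRot ^ j * g`, so the sums over `j` are traces. The permutation character is the
2-dimensional one plus the trivial one; doubling it counts the trivial character once too often, and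
the subtracted `cWeight j g`, which sum to 1, correct this. -/
theorem weights_delta (g : Equiv.Perm (Fin 4)) :
    ∑ j : Fin 3, (3 * aWeight j (axisRot ^ (j : ℕ) * g) + 3 * bWeight j (axisRot ^ (j : ℕ) * g)
      + 2 * cWeight j (axisRot ^ (j : ℕ) * g) - cWeight j g) + dWeight g
      = if g = 1 then 24 else 0 := by
  revert g; decide +kernel

theorem exists_axis_eq (σ : Equiv.Perm (Fin 3)) : ∃ g, ∀ j, axis g j = σ j := by
  revert σ; decide +kernel

theorem axis_injective (g : Equiv.Perm (Fin 4)) : Function.Injective (axis g) := by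
  revert g; decide +kernel

theorem axisSign_prod (g : Equiv.Perm (Fin 4)) :
    axisSign g 0 * axisSign g 1 * axisSign g 2 = 1 := by
  revert g; decide +kernel

theorem sign_eq_one_of_axis (g : Equiv.Perm (Fin 4)) (h : ∀ j, axis g j = j) :
    Equiv.Perm.sign g = 1 := by
  revert g; decide +kernel

theorem exists_axisSign_eq (ε : Fin 3 → ℤˣ) (h : ε 0 * ε 1 * ε 2 = 1) :
    ∃ g, (∀ j, axis g j = j) ∧ ∀ j, axisSign g j = ε j := by
  revert ε; decide +kernel

/-- Even permutations fixing the axes realise sign changes of product 1; an odd permutation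
contributes product -1. -/
theorem exists_sign_align (δ δ' : Fin 3 → ℤˣ) :
    ∃ g, ∀ j, δ' j = Equiv.Perm.sign g * axisSign g j * δ (axis g j) := by
  revert δ δ'; decide +kernel

theorem exists_sign_align_of_sq_sum (δ δ' : Fin 3 → ℤˣ)
    (h : (∑ j, (δ j : ℤ)) ^ 2 = (∑ j, (δ' j : ℤ)) ^ 2) :
    ∃ g, (∀ j, axisSign g j = 1) ∧ ∀ j, δ' j = Equiv.Perm.sign g * δ (axis g j) := by
  revert δ δ'; decide +kernel

theorem sum_units_cases (δ : Fin 3 → ℤˣ) :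
    (∑ j, (δ j : ℤ)) = 1 ∨ (∑ j, (δ j : ℤ)) = -1 ∨ (∑ j, (δ j : ℤ)) = 3 ∨
      (∑ j, (δ j : ℤ)) = -3 := by
  revert δ; decide +kernel

theorem axis_eq_or_mul_swap (g : Equiv.Perm (Fin 4)) (h : axis g 2 = 2) :
    (axis g 0 = 0 ∧ ∀ j, axis g j = j) ∨
      (axis g 0 ≠ 0 ∧ ∀ j, axis (g * Equiv.swap 1 2) j = j) := by
  revert g; decide +kernel

theorem card_filter_axis :
    (Finset.univ.filter fun g : Equiv.Perm (Fin 4) => ∀ j, axis g j = j).card = 4 ∧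
    ((Finset.univ.filter fun g : Equiv.Perm (Fin 4) => axis g 2 = 2).filter
      fun g => axis g 0 = 0).card = 4 ∧
    ((Finset.univ.filter fun g : Equiv.Perm (Fin 4) => axis g 2 = 2).filter
      fun g => ¬ axis g 0 = 0).card = 4 := by
  decide +kernel

/-! ### Polynomial functions of bounded degree. -/

section PolyFun

variable {K : Type*} [Field K] {n : ℕ}

/-- Functions on `Kⁿ` given by polynomials of degree at most `d`. -/
def IsPolyFun (d : ℕ) (F : (Fin n → K) → K) : Prop :=
  ∃ p : MvPolynomial (Fin n) K, p.totalDegree ≤ d ∧ ∀ v, MvPolynomial.eval v p = F v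

theorem IsPolyFun.mono {d e : ℕ} {F : (Fin n → K) → K} (h : IsPolyFun d F) (hde : d ≤ e) :
    IsPolyFun e F := by
  obtain ⟨p, hp, hF⟩ := h
  exact ⟨p, hp.trans hde, hF⟩

theorem isPolyFun_const (d : ℕ) (c : K) : IsPolyFun d (fun _ : Fin n → K => c) :=
  ⟨MvPolynomial.C c, by simp, by simp⟩

theorem isPolyFun_apply (i : Fin n) : IsPolyFun 1 (fun v : Fin n → K => v i) :=
  ⟨MvPolynomial.X i, by simp, by simp⟩

theorem IsPolyFun.add {d : ℕ} {F F' : (Fin n → K) → K} (h : IsPolyFun d F)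
    (h' : IsPolyFun d F') : IsPolyFun d fun v => F v + F' v := by
  obtain ⟨p, hp, hF⟩ := h
  obtain ⟨q, hq, hF'⟩ := h'
  exact ⟨p + q, (MvPolynomial.totalDegree_add p q).trans (max_le hp hq), fun v => by
    rw [map_add, hF, hF']⟩

theorem IsPolyFun.mul {d e : ℕ} {F F' : (Fin n → K) → K} (h : IsPolyFun d F)
    (h' : IsPolyFun e F') : IsPolyFun (d + e) fun v => F v * F' v := by
  obtain ⟨p, hp, hF⟩ := h
  obtain ⟨q, hq, hF'⟩ := h'
  exact ⟨p * q, (MvPolynomial.totalDegree_mul p q).trans (add_le_add hp hq), fun v => by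
    rw [map_mul, hF, hF']⟩

theorem IsPolyFun.sub_const {d : ℕ} {F : (Fin n → K) → K} (h : IsPolyFun d F) (c : K) :
    IsPolyFun d fun v => F v - c := by
  simpa only [sub_eq_add_neg] using h.add (isPolyFun_const d (-c))

theorem IsPolyFun.const_mul {d : ℕ} {F : (Fin n → K) → K} (h : IsPolyFun d F) (c : K) :
    IsPolyFun d fun v => c * F v := by
  simpa only [zero_add] using (isPolyFun_const 0 c).mul h

theorem IsPolyFun.sum {ι : Type*} (s : Finset ι) {d : ℕ} {F : ι → (Fin n → K) → K}
    (h : ∀ i, IsPolyFun d (F i)) : IsPolyFun d fun v => ∑ i ∈ s, F i v := by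
  classical
  induction s using Finset.induction_on with
  | empty => simpa using isPolyFun_const d 0
  | insert i s hi ih => simpa only [Finset.sum_insert hi] using (h i).add ih

end PolyFun

/-! ### Linear action, invariants and orbit sums. -/

section Action

variable {K : Type*} [Field K] {n : ℕ} {G : Type*} [Group G]

/-- The linear action on `Kⁿ` defined by `ψ`. -/
def act (ψ : G →* Matrix.GeneralLinearGroup (Fin n) K) (g : G) (v : Fin n → K) : Fin n → K :=
  Matrix.mulVec (ψ g : Matrix (Fin n) (Fin n) K) v

variable (ψ : G →* Matrix.GeneralLinearGroup (Fin n) K)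

theorem act_one (v : Fin n → K) : act ψ 1 v = v := by simp [act]

theorem act_mul (g h : G) (v : Fin n → K) : act ψ (g * h) v = act ψ g (act ψ h v) := by
  simp [act, Matrix.mulVec_mulVec]

theorem act_inv_act (g : G) (v : Fin n → K) : act ψ g⁻¹ (act ψ g v) = v := by
  rw [← act_mul, inv_mul_cancel, act_one]

theorem act_sum_smul {ι : Type*} (s : Finset ι) (c : ι → K) (x : ι → Fin n → K) (g : G) :
    act ψ g (∑ i ∈ s, c i • x i) = ∑ i ∈ s, c i • act ψ g (x i) := by
  simp [act, Matrix.mulVec_sum, Matrix.mulVec_smul]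

theorem isPolyFun_act (g : G) (i : Fin n) : IsPolyFun 1 fun v => act ψ g v i := by
  simpa only [act, Matrix.mulVec, dotProduct] using
    IsPolyFun.sum Finset.univ fun j => (isPolyFun_apply j).const_mul _

theorem orbit_act (g : G) (v : Fin n → K) : orbit ψ (act ψ g v) = orbit ψ v := by
  ext x
  constructor
  · rintro ⟨h, rfl⟩
    exact ⟨h * g, act_mul ψ h g v⟩
  · rintro ⟨h, rfl⟩
    refine ⟨h * g⁻¹, ?_⟩
    change act ψ (h * g⁻¹) (act ψ g v) = act ψ h v
    rw [act_mul, act_inv_act]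

theorem eval_polyAct (g : G) (p : MvPolynomial (Fin n) K) (v : Fin n → K) :
    MvPolynomial.eval v (polyAct ψ g p) = MvPolynomial.eval (act ψ g⁻¹ v) p := by
  rw [polyAct, MvPolynomial.map_aeval, MvPolynomial.eval, MvPolynomial.coe_eval₂Hom,
    MvPolynomial.coe_eval₂Hom]
  congr 1
  · ext c
    simp
  · funext j
    simp [act, Matrix.mulVec, dotProduct]

theorem polyAct_mul (g h : G) (p : MvPolynomial (Fin n) K) :
    polyAct ψ (g * h) p = polyAct ψ g (polyAct ψ h p) := by
  rw [← AlgHom.comp_apply]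
  congr 1
  refine MvPolynomial.algHom_ext fun j => ?_
  simp only [polyAct, AlgHom.comp_apply, MvPolynomial.aeval_X, map_sum, map_mul, mul_inv_rev,
    MvPolynomial.algHom_C, MvPolynomial.algebraMap_eq, Units.val_mul, Matrix.mul_apply,
    Finset.sum_mul, Finset.mul_sum]
  rw [Finset.sum_comm]
  simp only [mul_assoc]

theorem totalDegree_polyAct_le (g : G) (p : MvPolynomial (Fin n) K) :
    (polyAct ψ g p).totalDegree ≤ p.totalDegree := by
  conv_lhs => rw [p.as_sum, map_sum]
  refine MvPolynomial.totalDegree_finsetSum_le fun m hm => ?_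
  have hX : ∀ j, (∑ i, MvPolynomial.C ((ψ g⁻¹ : Matrix (Fin n) (Fin n) K) j i) *
      MvPolynomial.X i : MvPolynomial (Fin n) K).IsHomogeneous 1 := fun j =>
    MvPolynomial.IsHomogeneous.sum _ _ _ fun i _ =>
      MvPolynomial.isHomogeneous_C_mul_X _ _
  have := (MvPolynomial.isHomogeneous_monomial (d := m) (p.coeff m) rfl).aeval _ hX
  refine this.totalDegree_le.trans ?_
  rw [one_mul]
  exact MvPolynomial.le_totalDegree hm

variable [Fintype G]

/-- The averages of polynomial functions of degree at most `9` over the orbits agree. -/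
def Moments (v w : Fin n → K) : Prop :=
  ∀ F, IsPolyFun 9 F → ∑ g, F (act ψ g v) = ∑ g, F (act ψ g w)

/-- Summing the translates of a polynomial gives an invariant of no larger degree, whose value is
the orbit sum. -/
theorem moments_of_invariants {v w : Fin n → K}
    (h : ∀ f ∈ invariants ψ, f.totalDegree ≤ 9 → MvPolynomial.eval v f = MvPolynomial.eval w f) :
    Moments ψ v w := by
  rintro F ⟨p, hp, hF⟩
  have key : ∀ x, MvPolynomial.eval x (∑ g, polyAct ψ g p) = ∑ g, F (act ψ g x) := by
    intro x
    simp only [map_sum, eval_polyAct, hF]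
    exact Fintype.sum_equiv (Equiv.inv G) _ _ fun g => rfl
  rw [← key, ← key]
  refine h _ (fun g => ?_) ?_
  · simp only [map_sum, ← polyAct_mul]
    exact Fintype.sum_equiv (Equiv.mulLeft g) _ _ fun h => rfl
  · exact MvPolynomial.totalDegree_finsetSum_le fun g _ => (totalDegree_polyAct_le ψ g p).trans hp

variable {ψ} {v w : Fin n → K}

theorem Moments.symm (h : Moments ψ v w) : Moments ψ w v := fun F hF => (h F hF).symm

theorem Moments.act_right (h : Moments ψ v w) (g : G) : Moments ψ v (act ψ g w) := by
  intro F hF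
  rw [h F hF]
  refine (Fintype.sum_equiv (Equiv.mulRight g) _ _ fun k => ?_).symm
  rw [Equiv.coe_mulRight, act_mul]

theorem Moments.act_left (h : Moments ψ v w) (g : G) : Moments ψ (act ψ g v) w :=
  (h.symm.act_right g).symm

theorem Moments.eq_of_invariant (h : Moments ψ v w) (hG : (Fintype.card G : K) ≠ 0)
    {F : (Fin n → K) → K} {d : ℕ} (hF : IsPolyFun d F) (hd : d ≤ 9)
    (hinv : ∀ g x, F (act ψ g x) = F x) : F v = F w := by
  have := h F (hF.mono hd)
  simp only [hinv, Finset.sum_const, Finset.card_univ, nsmul_eq_mul] at this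
  exact mul_left_cancel₀ hG this

/-- `J` serves as an indicator, up to the factor `κ`, of part of both orbits. It costs degree `m`
and restricts the equality of sums to that part. -/
theorem Moments.sum_filter (h : Moments ψ v w) {J F : (Fin n → K) → K} {m d : ℕ}
    (hJ : IsPolyFun m J) (hF : IsPolyFun d F) (hmd : m + d ≤ 9) {κ : K} (hκ : κ ≠ 0)
    (S : G → Prop) [DecidablePred S]
    (hv : ∀ g, J (act ψ g v) = if S g then κ else 0)
    (hw : ∀ g, J (act ψ g w) = if S g then κ else 0) :
    ∑ g with S g, F (act ψ g v) = ∑ g with S g, F (act ψ g w) := by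
  have := h _ ((hJ.mul hF).mono hmd)
  simp only [hv, hw, ite_mul, zero_mul, ← Finset.sum_filter, ← Finset.mul_sum] at this
  exact mul_left_cancel₀ hκ this

end Action

/-! ### Vectors up to sign and triples up to order. -/

/-- A symmetric tensor `x ⊗ x` of rank one fixes `x` up to a global sign: compare against one
nonzero entry. -/
theorem exists_units_smul_of_mul_eq {K : Type*} [Field K] {ι : Type*} {x y : ι → K}
    (h : ∀ i j, x i * x j = y i * y j) : ∃ u : ℤˣ, ∀ i, y i = ((u : ℤ) : K) * x i := by
  by_cases hx : ∃ i, x i ≠ 0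
  · obtain ⟨i, hi⟩ := hx
    rcases mul_self_eq_mul_self_iff.mp (h i i) with hy | hy
    · refine ⟨1, fun j => mul_left_cancel₀ hi ?_⟩
      have := h i j
      rw [← hy] at this
      simp [this]
    · refine ⟨-1, fun j => mul_left_cancel₀ hi ?_⟩
      have := h i j
      rw [show y i = - x i by rw [hy, neg_neg]] at this
      push_cast
      rw [mul_left_comm]
      rw [this]
      ring
  · push Not at hx
    refine ⟨1, fun j => ?_⟩
    have := h j j
    simpa [hx] using this.symm

theorem exists_perm_of_symm_eq {K : Type*} [Field K] {x y : Fin 3 → K}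
    (h1 : x 0 + x 1 + x 2 = y 0 + y 1 + y 2)
    (h2 : x 0 * x 1 + x 1 * x 2 + x 2 * x 0 = y 0 * y 1 + y 1 * y 2 + y 2 * y 0)
    (h3 : x 0 * x 1 * x 2 = y 0 * y 1 * y 2) :
    ∃ σ : Equiv.Perm (Fin 3), ∀ j, y (σ j) = x j := by
  have pair : ∀ {p q r s : K}, p + q = r + s → p * q = r * s → (p = r ∧ q = s) ∨ p = s ∧ q = r := by
    intro p q r s hs hp
    have : (p - r) * (p - s) = 0 := by linear_combination p * hs - hp
    rcases mul_eq_zero.mp this with h | h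
    · have hr := sub_eq_zero.mp h
      subst hr
      exact Or.inl ⟨rfl, add_left_cancel hs⟩
    · have hr := sub_eq_zero.mp h
      subst hr
      exact Or.inr ⟨rfl, by linear_combination hs⟩
  have root : (x 0 - y 0) * ((x 0 - y 1) * (x 0 - y 2)) = 0 := by
    linear_combination x 0 ^ 2 * h1 - x 0 * h2 + h3
  rcases mul_eq_zero.mp root with h | h
  · have h0 := sub_eq_zero.mp h
    rcases pair (p := x 1) (q := x 2) (r := y 1) (s := y 2) (by linear_combination h1 - h0)
      (by linear_combination h2 - x 0 * h1 + (x 0 - y 1 - y 2) * h0) with ⟨h4, h5⟩ | ⟨h4, h5⟩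
    · exact ⟨1, by simp [Fin.forall_fin_succ, h0, h4, h5]⟩
    · exact ⟨Equiv.swap 1 2, by simp [Fin.forall_fin_succ, h0, h4, h5, Equiv.swap_apply_def]⟩
  rcases mul_eq_zero.mp h with h | h
  · have h0 := sub_eq_zero.mp h
    rcases pair (p := x 1) (q := x 2) (r := y 0) (s := y 2) (by linear_combination h1 - h0)
      (by linear_combination h2 - x 0 * h1 + (x 0 - y 0 - y 2) * h0) with ⟨h4, h5⟩ | ⟨h4, h5⟩
    · exact ⟨Equiv.swap 0 1, by simp [Fin.forall_fin_succ, h0, h4, h5, Equiv.swap_apply_def]⟩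
    · exact ⟨Equiv.swap 0 2 * Equiv.swap 0 1,
        by simp [Fin.forall_fin_succ, h0, h4, h5, Equiv.swap_apply_def]⟩
  · have h0 := sub_eq_zero.mp h
    rcases pair (p := x 1) (q := x 2) (r := y 0) (s := y 1) (by linear_combination h1 - h0)
      (by linear_combination h2 - x 0 * h1 + (x 0 - y 0 - y 1) * h0) with ⟨h4, h5⟩ | ⟨h4, h5⟩
    · exact ⟨Equiv.swap 0 1 * Equiv.swap 0 2,
        by simp [Fin.forall_fin_succ, h0, h4, h5, Equiv.swap_apply_def]⟩
    · exact ⟨Equiv.swap 0 2, by simp [Fin.forall_fin_succ, h0, h4, h5, Equiv.swap_apply_def]⟩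

/-! ### Isotypic coordinates from the group algebra. -/

section Coordinates

variable {K : Type*} [Field K] {n : ℕ}
  (ψ : Equiv.Perm (Fin 4) →* Matrix.GeneralLinearGroup (Fin n) K)

/-- The image of `v` under the element of the group algebra with coefficients `A`. -/
def weightSum (A : Equiv.Perm (Fin 4) → ℤ) (v : Fin n → K) : Fin n → K :=
  ∑ g, (A g : K) • act ψ g v

theorem isPolyFun_weightSum (A : Equiv.Perm (Fin 4) → ℤ) (i : Fin n) :
    IsPolyFun 1 fun v => weightSum ψ A v i := by
  simpa only [weightSum, Finset.sum_apply, Pi.smul_apply, smul_eq_mul] using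
    IsPolyFun.sum Finset.univ fun g => (isPolyFun_act ψ g i).const_mul _

theorem weightSum_act (A : Equiv.Perm (Fin 4) → ℤ) (h : Equiv.Perm (Fin 4)) (v : Fin n → K) :
    weightSum ψ A (act ψ h v) = weightSum ψ (fun g => A (g * h⁻¹)) v := by
  refine Fintype.sum_equiv (Equiv.mulRight h) _ _ fun k => ?_
  simp [act_mul]

theorem act_weightSum (A : Equiv.Perm (Fin 4) → ℤ) (h : Equiv.Perm (Fin 4)) (v : Fin n → K) :
    act ψ h (weightSum ψ A v) = weightSum ψ (fun g => A (h⁻¹ * g)) v := by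
  rw [weightSum, act_sum_smul]
  refine Fintype.sum_equiv (Equiv.mulLeft h) _ _ fun k => ?_
  simp [act_mul]

theorem weightSum_const_mul (c : ℤ) (A : Equiv.Perm (Fin 4) → ℤ) (v : Fin n → K) :
    weightSum ψ (fun g => c * A g) v = (c : K) • weightSum ψ A v := by
  simp [weightSum, Finset.smul_sum, smul_smul]

/-- The axis coordinates of `v` in the isotypic component of the standard representation. -/
def aC (j : Fin 3) (v : Fin n → K) : Fin n → K := weightSum ψ (aWeight j) v

/-- The axis coordinates of `v` in the isotypic component of the rotation representation. -/
def bC (j : Fin 3) (v : Fin n → K) : Fin n → K := weightSum ψ (bWeight j) v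

/-- The axis coordinates of `v` in the fixed space of the normal Klein four group. -/
def cC (j : Fin 3) (v : Fin n → K) : Fin n → K := weightSum ψ (cWeight j) v

/-- The coordinate of `v` in the isotypic component of the sign character. -/
def dC (v : Fin n → K) : Fin n → K := weightSum ψ dWeight v

theorem aC_act (h : Equiv.Perm (Fin 4)) (j : Fin 3) (v : Fin n → K) :
    aC ψ j (act ψ h v) = ((axisSign h j : ℤ) : K) • aC ψ (axis h j) v := by
  simp only [aC, weightSum_act, aWeight_mul_inv, weightSum_const_mul]

theorem bC_act (h : Equiv.Perm (Fin 4)) (j : Fin 3) (v : Fin n → K) :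
    bC ψ j (act ψ h v)
      = (((Equiv.Perm.sign h * axisSign h j : ℤˣ) : ℤ) : K) • bC ψ (axis h j) v := by
  simp only [bC, weightSum_act, bWeight_mul_inv, weightSum_const_mul]

theorem cC_act (h : Equiv.Perm (Fin 4)) (j : Fin 3) (v : Fin n → K) :
    cC ψ j (act ψ h v) = cC ψ (axis h j) v := by
  simp only [cC, weightSum_act, cWeight_mul_inv]

theorem dC_act (h : Equiv.Perm (Fin 4)) (v : Fin n → K) :
    dC ψ (act ψ h v) = ((Equiv.Perm.sign h : ℤ) : K) • dC ψ v := by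
  simp only [dC, weightSum_act, dWeight_mul_inv, weightSum_const_mul]

theorem isPolyFun_aC (j : Fin 3) (i : Fin n) : IsPolyFun 1 fun v => aC ψ j v i :=
  isPolyFun_weightSum ψ _ i

theorem isPolyFun_bC (j : Fin 3) (i : Fin n) : IsPolyFun 1 fun v => bC ψ j v i :=
  isPolyFun_weightSum ψ _ i

theorem isPolyFun_cC (j : Fin 3) (i : Fin n) : IsPolyFun 1 fun v => cC ψ j v i :=
  isPolyFun_weightSum ψ _ i

theorem isPolyFun_dC (i : Fin n) : IsPolyFun 1 fun v => dC ψ v i :=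
  isPolyFun_weightSum ψ _ i

theorem smul_eq_sum_coordinates (v : Fin n → K) :
    (24 : K) • v = ∑ j : Fin 3, ((3 : K) • act ψ (axisRot ^ (j : ℕ))⁻¹ (aC ψ j v)
      + (3 : K) • act ψ (axisRot ^ (j : ℕ))⁻¹ (bC ψ j v)
      + (2 : K) • act ψ (axisRot ^ (j : ℕ))⁻¹ (cC ψ j v) - cC ψ j v) + dC ψ v := by
  simp only [aC, bC, cC, dC, act_weightSum, inv_inv]
  have h : ∀ g : Equiv.Perm (Fin 4), ((∑ j : Fin 3, (3 * aWeight j (axisRot ^ (j : ℕ) * g)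
      + 3 * bWeight j (axisRot ^ (j : ℕ) * g)
      + 2 * cWeight j (axisRot ^ (j : ℕ) * g) - cWeight j g) + dWeight g : ℤ) : K) • act ψ g v
      = if g = 1 then (24 : K) • v else 0 := by
    intro g
    rw [weights_delta]
    split_ifs with hg
    · rw [hg, act_one]; norm_num
    · simp
  have h24 := Finset.sum_congr (rfl : (Finset.univ : Finset (Equiv.Perm (Fin 4))) = _)
    fun g _ => h g
  rw [Finset.sum_ite_eq' Finset.univ (1 : Equiv.Perm (Fin 4)), if_pos (Finset.mem_univ _)] at h24
  rw [← h24]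
  simp only [weightSum, Finset.smul_sum, ← Finset.sum_add_distrib, ← Finset.sum_sub_distrib]
  rw [Finset.sum_comm, ← Finset.sum_add_distrib]
  refine Finset.sum_congr rfl fun g _ => ?_
  simp only [smul_smul, ← add_smul, ← sub_smul, ← Finset.sum_smul]
  push_cast
  rfl

variable {ψ}

theorem eq_of_coordinates_eq (h24 : (24 : K) ≠ 0) {v w : Fin n → K}
    (ha : ∀ j i, aC ψ j v i = aC ψ j w i) (hb : ∀ j i, bC ψ j v i = bC ψ j w i)
    (hc : ∀ j i, cC ψ j v i = cC ψ j w i) (hd : ∀ i, dC ψ v i = dC ψ w i) : v = w := by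
  have h : (24 : K) • v = (24 : K) • w := by
    rw [smul_eq_sum_coordinates ψ v, smul_eq_sum_coordinates ψ w]
    simp only [funext (ha _), funext (hb _), funext (hc _), funext hd]
  exact smul_right_injective _ h24 h

end Coordinates

/-! ### Separating Klein orbits in degree 3. -/

section Separation

variable {K : Type*} [Field K] {n : ℕ}
  {ψ : Equiv.Perm (Fin 4) →* Matrix.GeneralLinearGroup (Fin n) K}

theorem units_cast_mul_self (u : ℤˣ) : ((u : ℤ) : K) * ((u : ℤ) : K) = 1 := by
  rcases Int.units_eq_one_or u with rfl | rfl <;> norm_num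

theorem units_cast_injective (h2 : (2 : K) ≠ 0) {u u' : ℤˣ}
    (h : ((u : ℤ) : K) = ((u' : ℤ) : K)) : u = u' := by
  have h1 : (1 : K) ≠ -1 := fun h => h2 (by linear_combination h)
  rcases Int.units_eq_one_or u with rfl | rfl <;> rcases Int.units_eq_one_or u' with rfl | rfl
  · rfl
  · exact absurd (by simpa using h) h1
  · exact absurd (by simpa using h.symm) h1
  · rfl

variable (ψ) in
/-- Invariance of a function under the normal Klein four group. -/
def KleinInvariant (F : (Fin n → K) → K) : Prop :=
  ∀ g, (∀ j, axis g j = j) → ∀ x, F (act ψ g x) = F x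

theorem KleinInvariant.mul {F F' : (Fin n → K) → K} (h : KleinInvariant ψ F)
    (h' : KleinInvariant ψ F') : KleinInvariant ψ fun x => F x * F' x := fun g hg x => by
  simp only [h g hg x, h' g hg x]

variable (ψ) in
/-- The axis coordinates on which the Klein four group acts by signs. -/
def uC (j : Fin 3) (v : Fin n → K) : Fin n ⊕ Fin n → K := Sum.elim (aC ψ j v) (bC ψ j v)

theorem isPolyFun_uC (j : Fin 3) (i : Fin n ⊕ Fin n) : IsPolyFun 1 fun v => uC ψ j v i := by
  cases i with
  | inl i => exact isPolyFun_aC ψ j i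
  | inr i => exact isPolyFun_bC ψ j i

theorem uC_act {g : Equiv.Perm (Fin 4)} (hg : ∀ j, axis g j = j) (j : Fin 3) (v : Fin n → K)
    (i : Fin n ⊕ Fin n) : uC ψ j (act ψ g v) i = ((axisSign g j : ℤ) : K) * uC ψ j v i := by
  cases i with
  | inl i => simp [uC, aC_act, hg]
  | inr i => simp [uC, bC_act, hg, sign_eq_one_of_axis g hg]

/-- On each axis the Klein group acts by a sign, so quadratic products fix each `uC` vector up to
sign. The three signs must have product 1 to come from a group element; cubic products force this.
-/
theorem exists_act_eq_of_kleinInvariant (h24 : (24 : K) ≠ 0) (h2 : (2 : K) ≠ 0)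
    {v w : Fin n → K}
    (h : ∀ F, IsPolyFun 3 F → KleinInvariant ψ F → F v = F w) : ∃ g, act ψ g v = w := by
  have hc : ∀ j i, cC ψ j v i = cC ψ j w i := fun j i =>
    h _ ((isPolyFun_cC ψ j i).mono (by norm_num)) fun g hg x => by simp [cC_act, hg]
  have hd : ∀ i, dC ψ v i = dC ψ w i := fun i =>
    h _ ((isPolyFun_dC ψ i).mono (by norm_num)) fun g hg x => by
      simp [dC_act, sign_eq_one_of_axis g hg]
  have hu : ∀ j, ∃ ε : ℤˣ, ∀ i, uC ψ j w i = ((ε : ℤ) : K) * uC ψ j v i := fun j =>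
    exists_units_smul_of_mul_eq fun i i' =>
      h _ (((isPolyFun_uC j i).mul (isPolyFun_uC j i')).mono (by norm_num)) fun g hg x => by
        simp only [uC_act hg]
        linear_combination (uC ψ j x i * uC ψ j x i') * units_cast_mul_self (K := K) (axisSign g j)
  have hp : ∀ i₀ i₁ i₂, uC ψ 0 v i₀ * uC ψ 1 v i₁ * uC ψ 2 v i₂
      = uC ψ 0 w i₀ * uC ψ 1 w i₁ * uC ψ 2 w i₂ := fun i₀ i₁ i₂ =>
    h _ (((isPolyFun_uC 0 i₀).mul (isPolyFun_uC 1 i₁)).mul (isPolyFun_uC 2 i₂)) fun g hg x => by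
      simp only [uC_act hg]
      have := congrArg (fun u : ℤˣ => ((u : ℤ) : K)) (axisSign_prod g)
      push_cast at this
      linear_combination (uC ψ 0 x i₀ * uC ψ 1 x i₁ * uC ψ 2 x i₂) * this
  obtain ⟨ε, hε, hε1⟩ : ∃ ε : Fin 3 → ℤˣ,
      (∀ j i, uC ψ j w i = ((ε j : ℤ) : K) * uC ψ j v i) ∧ ε 0 * ε 1 * ε 2 = 1 := by
    choose ε hε using hu
    by_cases hz : ∃ j, ∀ i, uC ψ j v i = 0
    · obtain ⟨j, hj⟩ := hz
      -- The sign on an axis with zero coordinates is free, so it can absorb the total product.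
      refine ⟨Function.update ε j (ε j * (ε 0 * ε 1 * ε 2)), fun k i => ?_, ?_⟩
      · by_cases hkj : k = j
        · subst hkj
          rw [hε, hj, mul_zero, mul_zero]
        · rw [Function.update_of_ne hkj, hε]
      · have : ∀ j (ε : Fin 3 → ℤˣ), Function.update ε j (ε j * (ε 0 * ε 1 * ε 2)) 0
          * Function.update ε j (ε j * (ε 0 * ε 1 * ε 2)) 1
          * Function.update ε j (ε j * (ε 0 * ε 1 * ε 2)) 2 = 1 := by decide +kernel
        exact this j ε
    · push Not at hz
      choose i hi using hz
      refine ⟨ε, hε, units_cast_injective h2 (K := K) ?_⟩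
      have := hp (i 0) (i 1) (i 2)
      simp only [hε] at this
      refine mul_right_cancel₀ (mul_ne_zero (mul_ne_zero (hi 0) (hi 1)) (hi 2)) ?_
      push_cast
      linear_combination -this
  obtain ⟨g, hg, hgε⟩ := exists_axisSign_eq ε hε1
  have hu : ∀ j i, uC ψ j (act ψ g v) i = uC ψ j w i := fun j i => by
    rw [uC_act hg, hε, hgε]
  refine ⟨g, eq_of_coordinates_eq (ψ := ψ) h24 (fun j i => hu j (Sum.inl i))
    (fun j i => hu j (Sum.inr i)) (fun j i => ?_) fun i => ?_⟩
  · rw [cC_act, hg, hc]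
  · rw [dC_act, sign_eq_one_of_axis g hg, ← hd]
    simp

theorem Moments.eq_of_invariant' {v w : Fin n → K} (h : Moments ψ v w) (h24 : (24 : K) ≠ 0)
    {F : (Fin n → K) → K} {d : ℕ} (hF : IsPolyFun d F) (hd : d ≤ 9)
    (hinv : ∀ g x, F (act ψ g x) = F x) : F v = F w := by
  refine h.eq_of_invariant ?_ hF hd hinv
  rw [Fintype.card_perm, Fintype.card_fin]
  simpa [Nat.factorial] using h24

/-! ### Functions permuted like the axes. -/

variable (ψ) in
/-- A family of functions permuted by the group like the three axes. -/
def AxisFamily (e : Fin 3 → (Fin n → K) → K) : Prop :=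
  ∀ g j x, e j (act ψ g x) = e (axis g j) x

theorem sum_axis {M : Type*} [AddCommMonoid M] (g : Equiv.Perm (Fin 4)) (f : Fin 3 → M) :
    ∑ j, f (axis g j) = ∑ j, f j :=
  (Equiv.ofBijective _ (Finite.injective_iff_bijective.mp (axis_injective g))).sum_comp f

theorem prod_axis {M : Type*} [CommMonoid M] (g : Equiv.Perm (Fin 4)) (f : Fin 3 → M) :
    ∏ j, f (axis g j) = ∏ j, f j :=
  (Equiv.ofBijective _ (Finite.injective_iff_bijective.mp (axis_injective g))).prod_comp f

theorem Moments.exists_align {v w : Fin n → K} (h : Moments ψ v w) (h24 : (24 : K) ≠ 0)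
    (h2 : (2 : K) ≠ 0) {e : Fin 3 → (Fin n → K) → K} (he : AxisFamily ψ e)
    (hp : ∀ j, IsPolyFun 2 (e j)) : ∃ g, ∀ j, e j (act ψ g w) = e j v := by
  have h1 : ∑ j, e j v = ∑ j, e j w :=
    h.eq_of_invariant' h24 (IsPolyFun.sum _ hp) (by norm_num) fun g x => by
      simp only [he g _ x]
      exact sum_axis g fun j => e j x
  have hsq : ∑ j, e j v * e j v = ∑ j, e j w * e j w :=
    h.eq_of_invariant' h24 (IsPolyFun.sum _ fun j => (hp j).mul (hp j)) (by norm_num) fun g x => by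
      simp only [he g _ x]
      exact sum_axis g fun j => e j x * e j x
  have h3 : e 0 v * e 1 v * e 2 v = e 0 w * e 1 w * e 2 w :=
    h.eq_of_invariant' h24 (((hp 0).mul (hp 1)).mul (hp 2)) (by norm_num) fun g x => by
      simp only [he g _ x]
      simpa only [Fin.prod_univ_three] using prod_axis g fun j => e j x
  simp only [Fin.sum_univ_three] at h1 hsq
  obtain ⟨σ, hσ⟩ := exists_perm_of_symm_eq (x := fun j => e j v) (y := fun j => e j w) h1
    -- The second elementary symmetric function comes from the power sums, hence the division by 2.
    (mul_left_cancel₀ h2 (by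
      linear_combination (e 0 v + e 1 v + e 2 v + e 0 w + e 1 w + e 2 w) * h1 - hsq)) h3
  obtain ⟨g, hg⟩ := exists_axis_eq σ
  exact ⟨g, fun j => by rw [he, hg, hσ]⟩

theorem exists_act_eq_of_injective {v w : Fin n → K} (h : Moments ψ v w) (h24 : (24 : K) ≠ 0)
    (h2 : (2 : K) ≠ 0) {e : Fin 3 → (Fin n → K) → K} (he : AxisFamily ψ e)
    (hp : ∀ j, IsPolyFun 2 (e j)) (hvw : ∀ j, e j w = e j v)
    (hinj : Function.Injective fun j => e j v) : ∃ g, act ψ g v = w := by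
  refine exists_act_eq_of_kleinInvariant h24 h2 fun F hF hinv => ?_
  -- A Vandermonde-type product of degree 6: with distinct values it is nonzero only where the axes
  -- are in their original order.
  have hJ := (((hp 0).sub_const (e 1 v)).mul ((hp 0).sub_const (e 2 v))).mul
    ((hp 1).sub_const (e 2 v))
  have hz : ∀ {i j : Fin 3}, e i v - e j v = 0 ↔ i = j := fun {i j} => by
    rw [sub_eq_zero]
    exact hinj.eq_iff
  have hval : ∀ g, (e (axis g 0) v - e 1 v) * (e (axis g 0) v - e 2 v) * (e (axis g 1) v - e 2 v)
      = if ∀ j, axis g j = j then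
        (e 0 v - e 1 v) * (e 0 v - e 2 v) * (e 1 v - e 2 v) else 0 := by
    intro g
    split_ifs with hg
    · rw [hg, hg]
    · rw [mul_eq_zero, mul_eq_zero, hz, hz, hz]
      have : ∀ g, (¬ ∀ j, axis g j = j) → (axis g 0 = 1 ∨ axis g 0 = 2) ∨ axis g 1 = 2 := by
        decide +kernel
      exact this g hg
  have hκ : (e 0 v - e 1 v) * (e 0 v - e 2 v) * (e 1 v - e 2 v) ≠ 0 := by
    simp only [ne_eq, mul_eq_zero, hz]
    decide
  have key := h.sum_filter hJ hF (by norm_num) hκ (fun g => ∀ j, axis g j = j)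
    (fun g => by rw [he, he]; exact hval g)
    (fun g => by rw [he, he, hvw, hvw]; exact hval g)
  have hs : ∀ x, ∑ g with ∀ j, axis g j = j, F (act ψ g x) = 4 * F x := fun x => by
    rw [Finset.sum_congr rfl fun g hg => hinv g (Finset.mem_filter.mp hg).2 x, Finset.sum_const,
      card_filter_axis.1, nsmul_eq_mul]
    norm_num
  rw [hs, hs] at key
  refine mul_left_cancel₀ (fun h4 => h24 ?_) key
  linear_combination 6 * h4

theorem sum_filter_axis_two {F : (Fin n → K) → K} (hinv : KleinInvariant ψ F) (x : Fin n → K) :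
    ∑ g with axis g 2 = 2, F (act ψ g x) = 4 * (F x + F (act ψ (Equiv.swap 1 2) x)) := by
  have : ∀ g ∈ Finset.univ.filter fun g : Equiv.Perm (Fin 4) => axis g 2 = 2,
      F (act ψ g x) = if axis g 0 = 0 then F x else F (act ψ (Equiv.swap 1 2) x) := by
    intro g hg
    rcases axis_eq_or_mul_swap g (Finset.mem_filter.mp hg).2 with ⟨h0, h1⟩ | ⟨h0, h1⟩
    · rw [if_pos h0, hinv g h1]
    · rw [if_neg h0, ← hinv _ h1 (act ψ (Equiv.swap 1 2) x), ← act_mul, mul_assoc, Equiv.swap_mul_self, mul_one]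
  rw [Finset.sum_congr rfl this, Finset.sum_ite, Finset.sum_const, Finset.sum_const,
    card_filter_axis.2.1, card_filter_axis.2.2]
  simp only [nsmul_eq_mul]
  push_cast
  ring

/-- Isolating axis 2 leaves the Klein group extended by `τ`, so only sums over `{v, τ v}` are known.
Applied to products `F F'`, these give the products of the differences `F v - F (τ v)`, hence all
differences up to one common sign. That sign decides whether `w` is a Klein translate of `v` or of
`τ v`. Products need degree 6, within the available 7. -/
theorem exists_act_eq_of_pair {v w : Fin n → K} (h : Moments ψ v w) (h24 : (24 : K) ≠ 0)
    (h2 : (2 : K) ≠ 0) {e : Fin 3 → (Fin n → K) → K} (he : AxisFamily ψ e)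
    (hp : ∀ j, IsPolyFun 2 (e j)) (hvw : ∀ j, e j w = e j v)
    (h01 : e 0 v = e 1 v) (h02 : e 2 v ≠ e 0 v) : ∃ g, act ψ g v = w := by
  set τ : Equiv.Perm (Fin 4) := Equiv.swap 1 2
  have hval : ∀ g, e (axis g 2) v - e 0 v = if axis g 2 = 2 then e 2 v - e 0 v else 0 := by
    intro g
    split_ifs with hg
    · rw [hg]
    · have : ∀ j : Fin 3, j ≠ 2 → j = 0 ∨ j = 1 := by decide
      rcases this _ hg with h | h <;> rw [h]
      · rw [sub_self]
      · rw [h01, sub_self]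
  have key : ∀ F, IsPolyFun 7 F → KleinInvariant ψ F →
      F v + F (act ψ τ v) = F w + F (act ψ τ w) := by
    intro F hF hinv
    have := h.sum_filter ((hp 2).sub_const (e 0 v)) hF (by norm_num) (sub_ne_zero.mpr h02)
      (fun g => axis g 2 = 2) (fun g => by rw [he]; exact hval g)
      (fun g => by rw [he, hvw]; exact hval g)
    rw [sum_filter_axis_two hinv, sum_filter_axis_two hinv] at this
    refine mul_left_cancel₀ (fun h4 => h24 ?_) this
    linear_combination 6 * h4
  obtain ⟨u, hu⟩ := exists_units_smul_of_mul_eq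
    (ι := {F : (Fin n → K) → K // IsPolyFun 3 F ∧ KleinInvariant ψ F})
    (x := fun F => F.1 v - F.1 (act ψ τ v)) (y := fun F => F.1 w - F.1 (act ψ τ w))
    (by
      rintro ⟨F, hF, hFi⟩ ⟨F', hF', hFi'⟩
      have h1 := key F (hF.mono (by norm_num)) hFi
      have h1' := key F' (hF'.mono (by norm_num)) hFi'
      have h3 := key _ ((hF.mul hF').mono (by norm_num)) (hFi.mul hFi')
      dsimp only at h3 ⊢
      linear_combination 2 * h3 - (F' v + F' (act ψ τ v)) * h1
        - (F w + F (act ψ τ w)) * h1')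
  rcases Int.units_eq_one_or u with rfl | rfl
  · refine exists_act_eq_of_kleinInvariant h24 h2 fun F hF hinv => mul_left_cancel₀ h2 ?_
    have h1 := key F (hF.mono (by norm_num)) hinv
    have h3 := hu ⟨F, hF, hinv⟩
    push_cast at h3
    linear_combination h1 - h3
  · obtain ⟨g, hg⟩ := exists_act_eq_of_kleinInvariant (v := act ψ τ v) (w := w) h24 h2
      fun F hF hinv => mul_left_cancel₀ h2 (by
        have h1 := key F (hF.mono (by norm_num)) hinv
        have h3 := hu ⟨F, hF, hinv⟩
        push_cast at h3
        linear_combination h1 - h3)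
    exact ⟨g * τ, by rw [act_mul, hg]⟩

theorem exists_act_eq_of_nonconstant {v w : Fin n → K} (h : Moments ψ v w) (h24 : (24 : K) ≠ 0)
    (h2 : (2 : K) ≠ 0) {e : Fin 3 → (Fin n → K) → K} (he : AxisFamily ψ e)
    (hp : ∀ j, IsPolyFun 2 (e j)) (hne : ∃ j k, e j v ≠ e k v) : ∃ g, act ψ g v = w := by
  by_cases hinj : Function.Injective fun j => e j v
  · obtain ⟨g, hg⟩ := h.exists_align h24 h2 he hp
    obtain ⟨k, hk⟩ := exists_act_eq_of_injective (h.act_right g) h24 h2 he hp hg hinj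
    exact ⟨g⁻¹ * k, by rw [act_mul, hk, act_inv_act]⟩
  · obtain ⟨σ, h01, h02⟩ : ∃ σ : Equiv.Perm (Fin 3),
        e (σ 0) v = e (σ 1) v ∧ e (σ 2) v ≠ e (σ 0) v := by
      rw [Function.Injective] at hinj
      push Not at hinj
      obtain ⟨i, j, hij, hne'⟩ := hinj
      have : ∀ i j : Fin 3, i ≠ j → ∃ σ : Equiv.Perm (Fin 3), σ 0 = i ∧ σ 1 = j := by
        decide +kernel
      obtain ⟨σ, rfl, rfl⟩ := this i j hne'
      refine ⟨σ, hij, fun h20 => ?_⟩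
      have hall : ∀ j, e j v = e (σ 0) v := by
        intro j
        obtain ⟨i, rfl⟩ := σ.surjective j
        fin_cases i
        · rfl
        · exact hij.symm
        · exact h20
      obtain ⟨j, k, hjk⟩ := hne
      exact hjk ((hall j).trans (hall k).symm)
    obtain ⟨s, hs⟩ := exists_axis_eq σ
    have h' := h.act_left s
    obtain ⟨g, hg⟩ := h'.exists_align h24 h2 he hp
    obtain ⟨k, hk⟩ := exists_act_eq_of_pair (h'.act_right g) h24 h2 he hp hg
      (by rwa [he, he, hs, hs]) (by rwa [he, he, hs, hs])
    exact ⟨g⁻¹ * k * s, by rw [act_mul, act_mul, hk, act_inv_act]⟩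

theorem axisFamily_aC (i i' : Fin n) : AxisFamily ψ fun j x => aC ψ j x i * aC ψ j x i' :=
  fun g j x => by
    simp only [aC_act, Pi.smul_apply, smul_eq_mul]
    linear_combination (aC ψ (axis g j) x i * aC ψ (axis g j) x i') *
      units_cast_mul_self (K := K) (axisSign g j)

theorem axisFamily_bC (i i' : Fin n) : AxisFamily ψ fun j x => bC ψ j x i * bC ψ j x i' :=
  fun g j x => by
    simp only [bC_act, Pi.smul_apply, smul_eq_mul]
    linear_combination (bC ψ (axis g j) x i * bC ψ (axis g j) x i') *
      units_cast_mul_self (K := K) (Equiv.Perm.sign g * axisSign g j)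

theorem axisFamily_cC (i : Fin n) : AxisFamily ψ fun j x => cC ψ j x i :=
  fun g j x => by simp only [cC_act]

/-! ### Points at which the axes are indistinguishable. -/

variable (ψ) in
/-- All functions permuted like the axes are constant on the axes at `v`. -/
def AxisConstant (v : Fin n → K) : Prop :=
  ∀ e : Fin 3 → (Fin n → K) → K, AxisFamily ψ e → (∀ j, IsPolyFun 2 (e j)) →
    ∀ j k, e j v = e k v

theorem AxisConstant.act {v : Fin n → K} (h : AxisConstant ψ v) (g : Equiv.Perm (Fin 4)) :
    AxisConstant ψ (act ψ g v) := fun e he hp j k => by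
  rw [he, he]
  exact h e he hp _ _

theorem AxisConstant.aC_mul {v : Fin n → K} (h : AxisConstant ψ v) (j k : Fin 3) (i i' : Fin n) :
    aC ψ j v i * aC ψ j v i' = aC ψ k v i * aC ψ k v i' :=
  h _ (axisFamily_aC i i') (fun j => (isPolyFun_aC ψ j i).mul (isPolyFun_aC ψ j i')) j k

theorem AxisConstant.bC_mul {v : Fin n → K} (h : AxisConstant ψ v) (j k : Fin 3) (i i' : Fin n) :
    bC ψ j v i * bC ψ j v i' = bC ψ k v i * bC ψ k v i' :=
  h _ (axisFamily_bC i i') (fun j => (isPolyFun_bC ψ j i).mul (isPolyFun_bC ψ j i')) j k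

theorem AxisConstant.family_eq {v w : Fin n → K} (h : Moments ψ v w) (h24 : (24 : K) ≠ 0)
    (hv : AxisConstant ψ v) (hw : AxisConstant ψ w) {e : Fin 3 → (Fin n → K) → K}
    (he : AxisFamily ψ e) (hp : ∀ j, IsPolyFun 2 (e j)) (j k : Fin 3) : e j v = e k w := by
  have h1 : ∑ j, e j v = ∑ j, e j w :=
    h.eq_of_invariant' h24 (IsPolyFun.sum _ hp) (by norm_num) fun g x => by
      simp only [he g _ x]
      exact sum_axis g fun j => e j x
  have hs : ∀ x, AxisConstant ψ x → ∀ k, ∑ j, e j x = 3 * e k x := fun x hx k => by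
    rw [Finset.sum_congr rfl fun j _ => hx e he hp j k, Finset.sum_const]
    simp
  rw [hs v hv j, hs w hw k] at h1
  refine mul_left_cancel₀ (fun h3 => h24 ?_) h1
  linear_combination 8 * h3

/-- The vectors agree up to signs `ε j`. Multiplying all three by their product makes the total
product 1, so a Klein element realises the change. -/
theorem AxisConstant.exists_aC_eq {v : Fin n → K} (hv : AxisConstant ψ v) :
    ∃ g, ∀ j, aC ψ j (SepNoether.act ψ g v) = aC ψ 0 (SepNoether.act ψ g v) := by
  have : ∀ j, ∃ u : ℤˣ, ∀ i, aC ψ j v i = ((u : ℤ) : K) * aC ψ 0 v i := fun j =>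
    exists_units_smul_of_mul_eq fun i i' => hv.aC_mul 0 j i i'
  choose ε hε using this
  have hε1 : ∀ ε : Fin 3 → ℤˣ, ε 0 * (ε 0 * ε 1 * ε 2) * (ε 1 * (ε 0 * ε 1 * ε 2))
      * (ε 2 * (ε 0 * ε 1 * ε 2)) = 1 := by decide +kernel
  obtain ⟨g, hg, hgε⟩ := exists_axisSign_eq (fun j => ε j * (ε 0 * ε 1 * ε 2)) (hε1 ε)
  have h : ∀ j i, aC ψ j (SepNoether.act ψ g v) i
      = ((ε 0 * ε 1 * ε 2 : ℤˣ) : ℤ) * aC ψ 0 v i := fun j i => by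
    rw [aC_act, hg, hgε, Pi.smul_apply, smul_eq_mul, hε]
    push_cast
    linear_combination (((ε 0 : ℤ) : K) * ((ε 1 : ℤ) : K) * ((ε 2 : ℤ) : K) * aC ψ 0 v i) *
      units_cast_mul_self (K := K) (ε j)
  exact ⟨g, fun j => funext fun i => (h j i).trans (h 0 i).symm⟩

variable (ψ) in
/-- The pairing of an `a`-coordinate with a `b`-coordinate. -/
def abSum (i i' : Fin n) (x : Fin n → K) : K := ∑ j, aC ψ j x i * bC ψ j x i'

theorem isPolyFun_abSum (i i' : Fin n) : IsPolyFun 2 (abSum ψ i i') :=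
  IsPolyFun.sum _ fun j => (isPolyFun_aC ψ j i).mul (isPolyFun_bC ψ j i')

theorem abSum_act (i i' : Fin n) (g : Equiv.Perm (Fin 4)) (x : Fin n → K) :
    abSum ψ i i' (act ψ g x) = ((Equiv.Perm.sign g : ℤ) : K) * abSum ψ i i' x := by
  have : ∀ j, aC ψ j (act ψ g x) i * bC ψ j (act ψ g x) i' = ((Equiv.Perm.sign g : ℤ) : K) *
      (aC ψ (axis g j) x i * bC ψ (axis g j) x i') := fun j => by
    rw [aC_act, bC_act]
    simp only [Pi.smul_apply, smul_eq_mul]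
    push_cast
    linear_combination (((Equiv.Perm.sign g : ℤ) : K) * aC ψ (axis g j) x i *
      bC ψ (axis g j) x i') * units_cast_mul_self (K := K) (axisSign g j)
  simp only [abSum, this, ← Finset.mul_sum]
  rw [sum_axis g fun j => aC ψ j x i * bC ψ j x i']

theorem Moments.exists_dC_eq {v w : Fin n → K} (h : Moments ψ v w) (h24 : (24 : K) ≠ 0) :
    ∃ u : ℤˣ, ∀ i, dC ψ w i = ((u : ℤ) : K) * dC ψ v i :=
  exists_units_smul_of_mul_eq fun i i' =>
    h.eq_of_invariant' h24 ((isPolyFun_dC ψ i).mul (isPolyFun_dC ψ i')) (by norm_num) fun g x => by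
      simp only [dC_act, Pi.smul_apply, smul_eq_mul]
      linear_combination (dC ψ x i * dC ψ x i') *
        units_cast_mul_self (K := K) (Equiv.Perm.sign g)

/-- The squares are 1 or 9, which stay distinct because 8 is invertible. -/
theorem sum_units_cast_sq_eq (h24 : (24 : K) ≠ 0) {δ δ' : Fin 3 → ℤˣ}
    (h : ((∑ j, (δ j : ℤ) : ℤ) : K) ^ 2 = ((∑ j, (δ' j : ℤ) : ℤ) : K) ^ 2) :
    (∑ j, (δ j : ℤ)) ^ 2 = (∑ j, (δ' j : ℤ)) ^ 2 := by
  have h8 : (8 : K) ≠ 0 := fun h8 => h24 (by linear_combination 3 * h8)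
  rcases sum_units_cases δ with hs | hs | hs | hs <;>
    rcases sum_units_cases δ' with hs' | hs' | hs' | hs' <;> rw [hs, hs'] at h ⊢ <;>
    first
    | norm_num; done
    | (exfalso
       push_cast at h
       first
       | exact h8 (by linear_combination h)
       | exact h8 (by linear_combination -h))

theorem sum_units_cast_ne_zero (h24 : (24 : K) ≠ 0) (δ : Fin 3 → ℤˣ) :
    ((∑ j, (δ j : ℤ) : ℤ) : K) ≠ 0 := by
  intro h
  rcases sum_units_cases δ with hs | hs | hs | hs <;> rw [hs] at h <;> push_cast at h <;>
    refine h24 ?_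
  · linear_combination 24 * h
  · linear_combination -24 * h
  · linear_combination 8 * h
  · linear_combination -8 * h

/-- The cubic invariant `∏ j, aC ψ j` removes the remaining sign of `aC`. The stabiliser of the
point 0 still acts, fixing all `aC`. The square of `abSum` tells how the signs of `bC` are
distributed, and `abSum` times `dC` then fixes `dC`. -/
theorem AxisConstant.exists_act_eq_of_aC_ne_zero {v w : Fin n → K} (h : Moments ψ v w)
    (h24 : (24 : K) ≠ 0) (h2 : (2 : K) ≠ 0) (hv : AxisConstant ψ v) (hw : AxisConstant ψ w)
    (hav : ∀ j, aC ψ j v = aC ψ 0 v) (haw : ∀ j, aC ψ j w = aC ψ 0 w) {α : Fin n}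
    (hα : aC ψ 0 v α ≠ 0) : ∃ g, SepNoether.act ψ g v = w := by
  obtain ⟨u, hu⟩ : ∃ u : ℤˣ, ∀ i, aC ψ 0 w i = ((u : ℤ) : K) * aC ψ 0 v i :=
    exists_units_smul_of_mul_eq fun i i' =>
      AxisConstant.family_eq h h24 hv hw (axisFamily_aC i i')
        (fun j => (isPolyFun_aC ψ j i).mul (isPolyFun_aC ψ j i')) 0 0
  have hprod : ∏ j, aC ψ j v α = ∏ j, aC ψ j w α := by
    refine h.eq_of_invariant' (F := fun x => ∏ j, aC ψ j x α) (d := 3) h24 ?_ (by norm_num)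
      fun g x => ?_
    · simpa only [Fin.prod_univ_three] using
        ((isPolyFun_aC ψ 0 α).mul (isPolyFun_aC ψ 1 α)).mul (isPolyFun_aC ψ 2 α)
    · have hs := congrArg (fun u : ℤˣ => ((u : ℤ) : K)) (axisSign_prod g)
      push_cast at hs
      simp only [aC_act, Pi.smul_apply, smul_eq_mul, Finset.prod_mul_distrib]
      rw [prod_axis g fun j => aC ψ j x α, Fin.prod_univ_three (fun j => ((axisSign g j : ℤ) : K)),
        hs, one_mul]
  have hu1 : u = 1 := by
    refine units_cast_injective h2 (K := K) ?_
    simp only [Fin.prod_univ_three, hav 1, hav 2, haw 1, haw 2, hu] at hprod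
    refine mul_right_cancel₀ (mul_ne_zero (mul_ne_zero hα hα) hα) ?_
    push_cast
    linear_combination -hprod - (((u : ℤ) : K) * aC ψ 0 v α * aC ψ 0 v α * aC ψ 0 v α) *
      units_cast_mul_self (K := K) u
  subst hu1
  have ha : ∀ j k, aC ψ j v = aC ψ k w := fun j k => by
    rw [hav, haw k]
    exact funext fun i => by simp [hu]
  have hc : ∀ j k i, cC ψ j v i = cC ψ k w i := fun j k i =>
    AxisConstant.family_eq h h24 hv hw (axisFamily_cC i)
      (fun j => (isPolyFun_cC ψ j i).mono (by norm_num)) j k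
  have hbb : ∀ j k i i', bC ψ j v i * bC ψ j v i' = bC ψ k w i * bC ψ k w i' := fun j k i i' =>
    AxisConstant.family_eq h h24 hv hw (axisFamily_bC i i')
      (fun j => (isPolyFun_bC ψ j i).mul (isPolyFun_bC ψ j i')) j k
  by_cases hb : ∀ i, bC ψ 0 v i = 0
  · have hbw : ∀ k i, bC ψ k w i = 0 := fun k i => by
      have := hbb 0 k i i
      rw [hb, mul_zero] at this
      exact mul_self_eq_zero.mp this.symm
    have hbv : ∀ j i, bC ψ j v i = 0 := fun j i => by
      have := hbb j 0 i i
      rw [hbw, mul_zero] at this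
      exact mul_self_eq_zero.mp this
    obtain ⟨u, hu⟩ := h.exists_dC_eq h24
    obtain ⟨g, hg, hgu⟩ : ∃ g, (∀ j, axisSign g j = 1) ∧ Equiv.Perm.sign g = u := by
      have : ∀ u : ℤˣ, ∃ g, (∀ j, axisSign g j = 1) ∧ Equiv.Perm.sign g = u := by
        decide +kernel
      exact this u
    refine ⟨g, eq_of_coordinates_eq (ψ := ψ) h24 (fun j i => ?_) (fun j i => ?_) (fun j i => ?_)
      fun i => ?_⟩
    · rw [aC_act, hg, ha _ j]
      simp
    · rw [bC_act, Pi.smul_apply, hbv, hbw, smul_zero]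
    · rw [cC_act, hc _ j]
    · rw [dC_act, hgu, hu, Pi.smul_apply, smul_eq_mul]
  · push Not at hb
    obtain ⟨β, hβ⟩ := hb
    have h1 : ∀ j, ∃ u : ℤˣ, ∀ i, bC ψ j v i = ((u : ℤ) : K) * bC ψ 0 v i := fun j =>
      exists_units_smul_of_mul_eq fun i i' => hv.bC_mul 0 j i i'
    have h1' : ∀ j, ∃ u : ℤˣ, ∀ i, bC ψ j w i = ((u : ℤ) : K) * bC ψ 0 v i := fun j =>
      exists_units_smul_of_mul_eq fun i i' => hbb 0 j i i'
    choose δ hδ using h1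
    choose δ' hδ' using h1'
    have hsv : abSum ψ α β v = aC ψ 0 v α * bC ψ 0 v β * ((∑ j, (δ j : ℤ) : ℤ) : K) := by
      simp only [abSum, hδ 1, hδ 2, Fin.sum_univ_three, hav 1, hav 2]
      push_cast
      linear_combination aC ψ 0 v α * hδ 0 β
    have hsw : abSum ψ α β w = aC ψ 0 v α * bC ψ 0 v β * ((∑ j, (δ' j : ℤ) : ℤ) : K) := by
      simp only [abSum, hδ', ← ha 0, Fin.sum_univ_three]
      push_cast
      ring
    have hsq : abSum ψ α β v * abSum ψ α β v = abSum ψ α β w * abSum ψ α β w :=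
      h.eq_of_invariant' h24 ((isPolyFun_abSum α β).mul (isPolyFun_abSum α β)) (by norm_num)
        fun g x => by
          simp only [abSum_act]
          linear_combination (abSum ψ α β x * abSum ψ α β x) *
            units_cast_mul_self (K := K) (Equiv.Perm.sign g)
    rw [hsv, hsw] at hsq
    -- The common factor `aC ψ 0 v α * bC ψ 0 v β` is nonzero and cancels, leaving the squared sums
    -- of signs.
    obtain ⟨g, hg, hgδ⟩ := exists_sign_align_of_sq_sum δ δ' (sum_units_cast_sq_eq h24 (K := K) (by
      refine mul_left_cancel₀ (mul_ne_zero (mul_ne_zero hα hβ) (mul_ne_zero hα hβ)) ?_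
      linear_combination hsq))
    have hga : ∀ j i, aC ψ j (SepNoether.act ψ g v) i = aC ψ j w i := fun j i => by
      rw [aC_act, hg, ha _ j]
      simp
    have hgb : ∀ j i, bC ψ j (SepNoether.act ψ g v) i = bC ψ j w i := fun j i => by
      rw [bC_act, hg, Pi.smul_apply, smul_eq_mul, hδ, hδ', hgδ]
      push_cast
      ring
    refine ⟨g, eq_of_coordinates_eq (ψ := ψ) h24 hga hgb (fun j i => ?_) fun i => ?_⟩
    · rw [cC_act, hc _ j]
    · have hd : abSum ψ α β (SepNoether.act ψ g v) * dC ψ (SepNoether.act ψ g v) i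
          = abSum ψ α β w * dC ψ w i :=
        (h.act_left g).eq_of_invariant' h24 ((isPolyFun_abSum α β).mul (isPolyFun_dC ψ i))
          (by norm_num) fun g x => by
            simp only [abSum_act, dC_act, Pi.smul_apply, smul_eq_mul]
            linear_combination (abSum ψ α β x * dC ψ x i) *
              units_cast_mul_self (K := K) (Equiv.Perm.sign g)
      have hs : abSum ψ α β (SepNoether.act ψ g v) = abSum ψ α β w := by
        simp only [abSum, hga, hgb]
      rw [hs] at hd
      refine mul_left_cancel₀ ?_ hd
      rw [hsw]
      exact mul_ne_zero (mul_ne_zero hα hβ) (sum_units_cast_ne_zero h24 δ')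

/-- With `aC` gone the whole group can align `bC`. The product of the `bC` coordinates changes by
the sign character, so its product with `dC` is an invariant of degree 4 that fixes `dC`. -/
theorem AxisConstant.exists_act_eq_of_aC_eq_zero {v w : Fin n → K} (h : Moments ψ v w)
    (h24 : (24 : K) ≠ 0) (hv : AxisConstant ψ v) (hw : AxisConstant ψ w)
    (hav : ∀ i, aC ψ 0 v i = 0) : ∃ g, SepNoether.act ψ g v = w := by
  have haa : ∀ j k i, aC ψ j v i * aC ψ j v i = aC ψ k w i * aC ψ k w i := fun j k i =>
    AxisConstant.family_eq h h24 hv hw (axisFamily_aC i i)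
      (fun j => (isPolyFun_aC ψ j i).mul (isPolyFun_aC ψ j i)) j k
  have haw : ∀ k i, aC ψ k w i = 0 := fun k i => by
    have := haa 0 k i
    rw [hav, mul_zero] at this
    exact mul_self_eq_zero.mp this.symm
  have hav : ∀ j i, aC ψ j v i = 0 := fun j i => by
    have := haa j 0 i
    rw [haw, mul_zero] at this
    exact mul_self_eq_zero.mp this
  have hc : ∀ j k i, cC ψ j v i = cC ψ k w i := fun j k i =>
    AxisConstant.family_eq h h24 hv hw (axisFamily_cC i)
      (fun j => (isPolyFun_cC ψ j i).mono (by norm_num)) j k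
  have hbb : ∀ j k i i', bC ψ j v i * bC ψ j v i' = bC ψ k w i * bC ψ k w i' := fun j k i i' =>
    AxisConstant.family_eq h h24 hv hw (axisFamily_bC i i')
      (fun j => (isPolyFun_bC ψ j i).mul (isPolyFun_bC ψ j i')) j k
  suffices ∃ g, (∀ j i, bC ψ j (SepNoether.act ψ g v) i = bC ψ j w i) ∧
      ∀ i, dC ψ (SepNoether.act ψ g v) i = dC ψ w i by
    obtain ⟨g, hb, hd⟩ := this
    refine ⟨g, eq_of_coordinates_eq (ψ := ψ) h24 (fun j i => ?_) hb (fun j i => ?_) hd⟩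
    · rw [aC_act, Pi.smul_apply, hav, haw, smul_zero]
    · rw [cC_act, hc _ j]
  by_cases hb : ∀ i, bC ψ 0 v i = 0
  · have hbw : ∀ k i, bC ψ k w i = 0 := fun k i => by
      have := hbb 0 k i i
      rw [hb, mul_zero] at this
      exact mul_self_eq_zero.mp this.symm
    have hbv : ∀ j i, bC ψ j v i = 0 := fun j i => by
      have := hbb j 0 i i
      rw [hbw, mul_zero] at this
      exact mul_self_eq_zero.mp this
    obtain ⟨u, hu⟩ := h.exists_dC_eq h24
    obtain ⟨g, hgu⟩ := Equiv.Perm.sign_surjective (Fin 4) u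
    refine ⟨g, fun j i => ?_, fun i => ?_⟩
    · rw [bC_act, Pi.smul_apply, hbv, hbw, smul_zero]
    · rw [dC_act, hgu, hu, Pi.smul_apply, smul_eq_mul]
  · push Not at hb
    obtain ⟨β, hβ⟩ := hb
    have h1 : ∀ j, ∃ u : ℤˣ, ∀ i, bC ψ j v i = ((u : ℤ) : K) * bC ψ 0 v i := fun j =>
      exists_units_smul_of_mul_eq fun i i' => hv.bC_mul 0 j i i'
    have h1' : ∀ j, ∃ u : ℤˣ, ∀ i, bC ψ j w i = ((u : ℤ) : K) * bC ψ 0 v i := fun j =>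
      exists_units_smul_of_mul_eq fun i i' => hbb 0 j i i'
    choose δ hδ using h1
    choose δ' hδ' using h1'
    obtain ⟨g, hgδ⟩ := exists_sign_align δ δ'
    have hgb : ∀ j i, bC ψ j (SepNoether.act ψ g v) i = bC ψ j w i := fun j i => by
      rw [bC_act, Pi.smul_apply, smul_eq_mul, hδ, hδ', hgδ]
      push_cast
      ring
    refine ⟨g, hgb, fun i => ?_⟩
    have hd : (∏ j, bC ψ j (SepNoether.act ψ g v) β) * dC ψ (SepNoether.act ψ g v) i
        = (∏ j, bC ψ j w β) * dC ψ w i := by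
      refine (h.act_left g).eq_of_invariant' (F := fun x => (∏ j, bC ψ j x β) * dC ψ x i)
        (d := 4) h24 ?_ (by norm_num) fun g x => ?_
      · simpa only [Fin.prod_univ_three] using
          (((isPolyFun_bC ψ 0 β).mul (isPolyFun_bC ψ 1 β)).mul (isPolyFun_bC ψ 2 β)).mul
            (isPolyFun_dC ψ i)
      · have hs : ((∏ j, ((Equiv.Perm.sign g * axisSign g j : ℤˣ) : ℤ) : ℤ) : K)
            * ((Equiv.Perm.sign g : ℤ) : K) = 1 := by
          have : (∏ j, ((Equiv.Perm.sign g * axisSign g j : ℤˣ) : ℤ))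
              * (Equiv.Perm.sign g : ℤ) = 1 := by
            revert g; decide +kernel
          exact_mod_cast congrArg (Int.cast : ℤ → K) this
        simp only [bC_act, dC_act, Pi.smul_apply, smul_eq_mul, Finset.prod_mul_distrib]
        rw [prod_axis g fun j => bC ψ j x β, ← Int.cast_prod]
        linear_combination ((∏ j, bC ψ j x β) * dC ψ x i) * hs
    simp only [hgb] at hd
    refine mul_left_cancel₀ (Finset.prod_ne_zero_iff.mpr fun j _ => ?_) hd
    intro h0
    have := hbb 0 j β β
    rw [h0, mul_zero] at this
    exact hβ (mul_self_eq_zero.mp this)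

theorem Moments.exists_act_eq {v w : Fin n → K} (h : Moments ψ v w)
    (h24 : (24 : K) ≠ 0) : ∃ g, act ψ g v = w := by
  have h2 : (2 : K) ≠ 0 := fun h2 => h24 (by linear_combination 12 * h2)
  by_cases hv : AxisConstant ψ v
  · by_cases hw : AxisConstant ψ w
    · obtain ⟨g, hg⟩ := hv.exists_aC_eq
      obtain ⟨k, hk⟩ := hw.exists_aC_eq
      have h' := (h.act_left g).act_right k
      obtain ⟨s, hs⟩ : ∃ s, act ψ s (act ψ g v) = act ψ k w := by
        by_cases ha : ∀ i, aC ψ 0 (act ψ g v) i = 0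
        · exact AxisConstant.exists_act_eq_of_aC_eq_zero h' h24 (hv.act g) (hw.act k) ha
        · push Not at ha
          obtain ⟨α, hα⟩ := ha
          exact AxisConstant.exists_act_eq_of_aC_ne_zero h' h24 h2 (hv.act g) (hw.act k) hg hk hα
      exact ⟨k⁻¹ * (s * g), by rw [act_mul, act_mul, hs, act_inv_act]⟩
    · rw [AxisConstant] at hw
      push Not at hw
      obtain ⟨e, he, hp, hne⟩ := hw
      obtain ⟨g, hg⟩ := exists_act_eq_of_nonconstant h.symm h24 h2 he hp hne
      exact ⟨g⁻¹, by rw [← hg, act_inv_act]⟩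
  · rw [AxisConstant] at hv
    push Not at hv
    obtain ⟨e, he, hp, hne⟩ := hv
    exact exists_act_eq_of_nonconstant h h24 h2 he hp hne

theorem sepNoetherOf_le_nine (h24 : (24 : K) ≠ 0) : sepNoetherOf ψ ≤ 9 := by
  refine iInf₂_le_of_le 9 ⟨by norm_num, fun f hf => hf.1, fun v w hvw => ?_⟩ le_rfl
  by_contra! hne
  obtain ⟨g, hg⟩ := (moments_of_invariants ψ fun f hf hd => hne f ⟨hf, hd⟩).exists_act_eq h24
  exact hvw (by rw [← hg, orbit_act])

end Separation

/-! ### Lower bound from the rotation representation. -/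

section Rotation

variable {K : Type*} [Field K]

variable (K) in
/-- The rotation representation of `S₄` on the cube by signed permutation matrices. -/
def rotRep : Equiv.Perm (Fin 4) →* Matrix.GeneralLinearGroup (Fin 3) K :=
  MonoidHom.toHomUnits
    { toFun := fun g => Matrix.of fun j k =>
        if axis g j = k then (((Equiv.Perm.sign g * axisSign g j : ℤˣ) : ℤ) : K) else 0
      map_one' := by
        ext j k
        simp [axis_one, axisSign_one, Matrix.one_apply]
      map_mul' := fun g h => by
        ext j k
        simp only [Matrix.mul_apply, Matrix.of_apply, axis_mul, axisSign_mul, ite_mul, zero_mul,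
          Finset.sum_ite_eq, Finset.mem_univ, if_true, map_mul]
        split_ifs
        · push_cast
          ring
        · rw [mul_zero] }

theorem act_rotRep (g : Equiv.Perm (Fin 4)) (x : Fin 3 → K) (j : Fin 3) :
    act (rotRep K) g x j
      = (((Equiv.Perm.sign g * axisSign g j : ℤˣ) : ℤ) : K) * x (axis g j) := by
  simp [act, rotRep, Matrix.mulVec, dotProduct]

/-- If exactly one exponent is odd, a Klein element negates that coordinate. If all are odd with sum
at most 8, two are equal, and an odd permutation exchanging their axes has sign product -1. -/
theorem exists_alternating (m : Fin 3 → ℕ) (hodd : Odd (∑ i, m i)) (hm : ∑ i, m i ≤ 8) :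
    ∃ h, (∀ i, m (axis h i) = m i) ∧
      ∏ i, (Equiv.Perm.sign h * axisSign h i) ^ m i = -1 := by
  have key : ∀ m₀ m₁ m₂ : Fin 9, (m₀ + m₁ + m₂ : ℕ) % 2 = 1 → (m₀ + m₁ + m₂ : ℕ) ≤ 8 →
      ∃ h, (∀ i, (![m₀, m₁, m₂] (axis h i)) = ![m₀, m₁, m₂] i) ∧
        ∏ i, (Equiv.Perm.sign h * axisSign h i) ^ ((![m₀, m₁, m₂] i : Fin 9) : ℕ) = -1 := by
    decide +kernel
  rw [Fin.sum_univ_three] at hodd hm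
  obtain ⟨h, h1, h2⟩ := key ⟨m 0, by omega⟩ ⟨m 1, by omega⟩ ⟨m 2, by omega⟩
    (Nat.odd_iff.mp hodd) hm
  have hval : ∀ i, ((![⟨m 0, by omega⟩, ⟨m 1, by omega⟩, ⟨m 2, by omega⟩] : Fin 3 → Fin 9) i : ℕ)
      = m i := by
    intro i
    fin_cases i <;> rfl
  refine ⟨h, fun i => ?_, ?_⟩
  · have := congrArg Fin.val (h1 i)
    rwa [hval, hval] at this
  · simpa only [hval] using h2

theorem sum_monomial_eq_zero (h2 : (2 : K) ≠ 0) (m : Fin 3 → ℕ) (hodd : Odd (∑ i, m i))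
    (hm : ∑ i, m i ≤ 8) (x : Fin 3 → K) :
    ∑ g, ∏ i, act (rotRep K) g x i ^ m i = 0 := by
  obtain ⟨h, h1, hs⟩ := exists_alternating m hodd hm
  have hs' : ∏ i, (((Equiv.Perm.sign h * axisSign h i : ℤˣ) : ℤ) : K) ^ m i = -1 := by
    have := congrArg (fun u : ℤˣ => ((u : ℤ) : K)) hs
    simpa using this
  have hneg : ∀ y : Fin 3 → K, ∏ i, act (rotRep K) h y i ^ m i = -∏ i, y i ^ m i := fun y => by
    simp only [act_rotRep, mul_pow, Finset.prod_mul_distrib, hs']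
    rw [← prod_axis h fun i => y i ^ m i]
    simp only [h1, neg_mul, one_mul]
  have hsum : ∑ g, ∏ i, act (rotRep K) g x i ^ m i
      = -∑ g, ∏ i, act (rotRep K) g x i ^ m i := by
    rw [← Finset.sum_neg_distrib]
    refine (Fintype.sum_equiv (Equiv.mulLeft h) _ _ fun g => ?_).symm
    rw [Equiv.coe_mulLeft, act_mul, hneg]
  refine (mul_eq_zero.mp ?_).resolve_left h2
  linear_combination hsum

theorem act_neg {n : ℕ} {G : Type*} [Group G] (ψ : G →* Matrix.GeneralLinearGroup (Fin n) K)
    (g : G) (v : Fin n → K) : act ψ g (-v) = -act ψ g v := by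
  simp [act, Matrix.mulVec_neg]

/-- Averaging over the group kills the monomials of odd degree; the rest are even functions. -/
theorem eval_neg_of_mem_invariants (h24 : (24 : K) ≠ 0) {f : MvPolynomial (Fin 3) K}
    (hf : f ∈ invariants (rotRep K)) (hd : f.totalDegree ≤ 8) (x : Fin 3 → K) :
    MvPolynomial.eval x f = MvPolynomial.eval (-x) f := by
  have h2 : (2 : K) ≠ 0 := fun h2 => h24 (by linear_combination 12 * h2)
  have havg : ∀ y, (24 : K) * MvPolynomial.eval y f
      = ∑ m ∈ f.support, f.coeff m * ∑ g, ∏ i, act (rotRep K) g y i ^ m i := by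
    intro y
    have hinv : ∀ g, MvPolynomial.eval (act (rotRep K) g y) f = MvPolynomial.eval y f := by
      intro g
      rw [← inv_inv g, ← eval_polyAct, hf]
    have : ∑ g, MvPolynomial.eval (act (rotRep K) g y) f = 24 * MvPolynomial.eval y f := by
      simp only [hinv, Finset.sum_const, Finset.card_univ, Fintype.card_perm, Fintype.card_fin,
        nsmul_eq_mul]
      norm_num [Nat.factorial]
    rw [← this]
    simp only [MvPolynomial.eval_eq', Finset.mul_sum]
    rw [Finset.sum_comm]
  refine mul_left_cancel₀ h24 ?_
  rw [havg, havg]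
  refine Finset.sum_congr rfl fun m hm => ?_
  congr 1
  rcases Nat.even_or_odd (∑ i, m i) with he | ho
  · refine Finset.sum_congr rfl fun g _ => ?_
    simp only [act_neg, Pi.neg_apply, neg_pow (act (rotRep K) g x _), Finset.prod_mul_distrib,
      Finset.prod_pow_eq_pow_sum, he.neg_one_pow, one_mul]
  · have hle : ∑ i, m i ≤ 8 := by
      refine le_trans (le_of_eq ?_) ((MvPolynomial.le_totalDegree hm).trans hd)
      rw [Finsupp.sum_fintype _ _ fun _ => rfl]
    rw [sum_monomial_eq_zero h2 _ ho hle, sum_monomial_eq_zero h2 _ ho hle]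

theorem orbit_rotRep_ne_neg (h2 : (2 : K) ≠ 0) {v : Fin 3 → K} (h0 : ∀ j, v j ≠ 0)
    (hsq : ∀ j k, v j ^ 2 = v k ^ 2 → j = k) : orbit (rotRep K) v ≠ orbit (rotRep K) (-v) := by
  intro h
  have hmem : -v ∈ orbit (rotRep K) v := by
    rw [h]
    exact ⟨1, act_one _ _⟩
  obtain ⟨g, hg⟩ := hmem
  have hg' : ∀ j, (((Equiv.Perm.sign g * axisSign g j : ℤˣ) : ℤ) : K) * v (axis g j) = -v j :=
    fun j => by rw [← act_rotRep]; exact congrFun hg j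
  -- Squaring removes the signs, so distinct squares force `g` into the Klein group, where the sign
  -- product is 1 and not -1.
  have hax : ∀ j, axis g j = j := fun j => hsq _ _ (by
    have := units_cast_mul_self (K := K) (Equiv.Perm.sign g * axisSign g j)
    linear_combination ((((Equiv.Perm.sign g * axisSign g j : ℤˣ) : ℤ) : K) * v (axis g j)
      - v j) * hg' j - v (axis g j) ^ 2 * this)
  have hneg : ∀ j, Equiv.Perm.sign g * axisSign g j = -1 := fun j =>
    units_cast_injective h2 (K := K) (mul_right_cancel₀ (h0 j) (by
      have := hg' j
      rw [hax] at this
      rw [this]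
      simp))
  revert g
  have : ∀ g, (∀ j, axis g j = j) → (∀ j, Equiv.Perm.sign g * axisSign g j = -1) → False := by
    decide +kernel
  exact fun g _ _ => this g

theorem nine_le_sepNoetherOf_rotRep (h24 : (24 : K) ≠ 0) {v : Fin 3 → K} (h0 : ∀ j, v j ≠ 0)
    (hsq : ∀ j k, v j ^ 2 = v k ^ 2 → j = k) : 9 ≤ sepNoetherOf (rotRep K) := by
  refine le_iInf₂ fun d hd => ?_
  by_contra hlt
  have hd8 : d ≤ 8 := by
    have : d < 9 := by exact_mod_cast not_le.mp hlt
    omega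
  obtain ⟨f, ⟨hf, hfd⟩, hne⟩ := hd.2.2 v (-v)
    (orbit_rotRep_ne_neg (fun h2 => h24 (by linear_combination 12 * h2)) h0 hsq)
  exact hne (eval_neg_of_mem_invariants h24 hf (hfd.trans hd8) v)

theorem exists_distinct_squares (h24 : (24 : K) ≠ 0)
    (hK : (∃ ξ : K, orderOf ξ = 24) ∨ ringChar K ≠ 5) :
    ∃ v : Fin 3 → K, (∀ j, v j ≠ 0) ∧ ∀ j k, v j ^ 2 = v k ^ 2 → j = k := by
  have h2 : (2 : K) ≠ 0 := fun h => h24 (by linear_combination 12 * h)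
  have h3 : (3 : K) ≠ 0 := fun h => h24 (by linear_combination 8 * h)
  -- The squares of 1 and 2 already differ since 3 is invertible; only a third square is needed.
  suffices ∃ z : K, z ≠ 0 ∧ z ^ 2 ≠ 1 ∧ z ^ 2 ≠ 4 by
    obtain ⟨z, hz0, hz1, hz2⟩ := this
    have h14 : (1 : K) ≠ 4 := fun h => h3 (by linear_combination -h)
    have h22 : (2 : K) ^ 2 = 4 := by norm_num
    refine ⟨![1, 2, z], ?_, ?_⟩
    · simp [Fin.forall_fin_succ, h2, hz0]
    · intro j k h
      fin_cases j <;> fin_cases k <;>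
        simp only [Fin.zero_eta, Fin.mk_one, Fin.reduceFinMk, Matrix.cons_val, one_pow, h22] at h ⊢
      exacts [absurd h h14, absurd h.symm hz1, absurd h.symm h14, absurd h.symm hz2,
        absurd h hz1, absurd h hz2]
  by_cases h5 : (5 : K) = 0
  · have hchar : ringChar K = 5 := by
      have hdvd : ringChar K ∣ 5 := (ringChar.spec K 5).mp (by exact_mod_cast h5)
      exact ((Nat.dvd_prime Nat.prime_five).mp hdvd).resolve_left (CharP.ringChar_ne_one)
    obtain ⟨ξ, hξ⟩ := hK.resolve_right fun h => h hchar
    have hpow : ∀ k, 0 < k → k < 24 → ξ ^ k ≠ 1 := fun k hk hk' h =>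
      absurd (Nat.le_of_dvd hk (hξ ▸ orderOf_dvd_of_pow_eq_one h)) (by omega)
    refine ⟨ξ, ?_, hpow 2 (by norm_num) (by norm_num), fun h => ?_⟩
    · rintro rfl
      rw [orderOf_zero] at hξ
      exact absurd hξ (by norm_num)
    -- In characteristic 5, `ξ ^ 2 = 4 = -1` would give `ξ ^ 4 = 1`.
    · exact hpow 4 (by norm_num) (by norm_num) (by linear_combination (ξ ^ 2 + 4) * h + 3 * h5)
  -- Here 9 - 4 = 5 and 9 - 1 = 8 are both nonzero.
  · refine ⟨3, h3, fun h => ?_, fun h => h5 (by linear_combination h)⟩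
    exact h24 (by linear_combination 3 * h)

end Rotation

end

end SepNoether

theorem mainTheorem9 {K : Type*} [Field K]
    (hchar : ¬ ringChar K ∣ Nat.card (Equiv.Perm (Fin 4)))
    (hK : (∃ ξ : K, orderOf ξ = 24) ∨ ringChar K ≠ 5) :
    SepNoether.sepNoetherNumber K (Equiv.Perm (Fin 4)) = 9 := by
  have h24 : (24 : K) ≠ 0 := fun h => hchar (by
    rw [Nat.card_eq_fintype_card, Fintype.card_perm, Fintype.card_fin]
    exact (ringChar.spec K _).mp (by simpa [Nat.factorial] using h))
  refine le_antisymm (iSup₂_le fun n ψ => SepNoether.sepNoetherOf_le_nine h24) ?_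
  obtain ⟨v, h0, hsq⟩ := SepNoether.exists_distinct_squares h24 hK
  exact (SepNoether.nine_le_sepNoetherOf_rotRep h24 h0 hsq).trans
    (le_iSup₂_of_le 3 (SepNoether.rotRep K) le_rfl)
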